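/- **Setting.** A dataset $D$ is a finite multiset of samples $(x,y)$. Two datasets are adjacent if one is obtained from the other by adding a single sample. A randomized algorithm $M$ is $(\varepsilon,\delta)$-DP if $\Pr[M(D)\in A]\le e^{\varepsilon}\Pr[M(D')\in A]+\delta$ for all adjacent $D,D'$ and all measurable sets $A$ of outputs. **Algorithm (normalized DPSGD with adaptive clipping).** Inputs: a number of iterations $T\in\mathbb N$; a sampling rate $q\in(0,1]$; a public nominal dataset size $N\ge 1$, which is an input and is not recomputed from $D$, with expected batch size $B=qN$; noise multipliers $\sigma_{\rm grad},\sigma_{\rm count}>0$; an initial clipping bound $C_0>0$; real numbers $\eta_C,\tau,\gamma,C_{\rm LB}$; a model $f_\theta$ with parameters $\theta\in\mathbb R^d$; a loss $\mathcal L$; a measurable and possibly stateful update rule $\mathrm{OptimizerUpdate}$, which sees only its own state, $\theta_t$ and the noisy gradient $\tilde g_t$; and an arbitrary data-independent initial distribution of $\theta_0$ and of the optimizer state. In the unbounded version $C_{\rm LB}$ is set to $0$; in the lower-bounded version the given $C_{\rm LB}$ is used. For $t=0,\dots,T-1$: 1. draw a Poisson subsample $\mathcal B_t$ of $D$: every sample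 is kept independently with probability $q$; 2. put $g_i=\nabla_\theta\mathcal L(f_{\theta_t}(x_i),y_i)$ (read as $0$ where the loss is not differentiable) and $\bar g_i=g_i\min(1/C_t,1/\|g_i\|)$ for $i\in\mathcal B_t$ (with $\bar g_i=0$ if $g_i=0$); 3. $\tilde g_t=\frac1B\bigl(\sum_{i\in\mathcal B_t}\bar g_i+\mathcal N(0,\sigma_{\rm grad}^2 I)\bigr)$ and $\theta_{t+1}=\mathrm{OptimizerUpdate}(\theta_t,\tilde g_t)$; 4. $b_t=|\{i\in\mathcal B_t:\|g_i\|>\tau C_t\}|$ and $\tilde b_t=\frac1B\bigl(b_t+\mathcal N(0,\sigma_{\rm count}^2)\bigr)$, with fresh independent noise; 5. $C_{t+1}=\max\bigl(C_{\rm LB},\,C_t\exp(\eta_C(\tilde b_t-\gamma))\bigr)$. **Accountants.** For $\sigma>0$ let $Q=\mathcal N(0,\sigma^2)$ and $P=(1-q)\,\mathcal N(0,\sigma^2)+q\,\mathcal N(1,\sigma^2)$ be the output laws of one step of the Poisson-subsampled Gaussian mechanism with sensitivity $1$ without and with the differing sample. Let $H_\varepsilon(\mu\|\nu)=\sup_A\bigl(\mu(A)-e^{\varepsilon}\nu(A)\bigr)$,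 over measurable $A$. A pair $(\varepsilon,\delta)$ of real numbers is *returned by a privacy accountant* for $(T,q,\sigma)$ if one of the following holds: * (privacy-profile accountant) $\delta\ge 0$ and $\delta\ge\max\bigl\{H_\varepsilon(P^{\otimes T}\|Q^{\otimes T}),\,H_\varepsilon(Q^{\otimes T}\|P^{\otimes T})\bigr\}$; * (Rényi-DP accountant) $\delta>0$ and there are $\alpha>1$ and $\rho\in\mathbb R$ such that $\max\{D_\alpha(P\|Q),D_\alpha(Q\|P)\}\le\rho$ and $\varepsilon\ge T\rho+\log\frac{\alpha-1}{\alpha}-\frac{\log\delta+\log\alpha}{\alpha-1}$, where $D_\alpha(\mu\|\nu)=\frac1{\alpha-1}\log\int\bigl(\frac{d\mu}{d\nu}\bigr)^{\alpha}d\nu$. **Theorem.** Both versions of the algorithm are well defined, in that their output laws are probability measures, and both are $(\varepsilon,\delta)$-DP for every pair $(\varepsilon,\delta)$ returned by a privacy accountant for $T$ iterations, sampling rate $q$ and noise multiplier $$\sigma=\bigl(\sigma_{\rm grad}^{-2}+\sigma_{\rm count}^{-2}\bigr)^{-1/2}.$$ This holds when the algorithm releases only $\theta_T$, and also when it releases its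 whole transcript: all $\theta_t$, $C_t$ and optimizer states for $0\le t\le T$, and all $\tilde g_t$, $\tilde b_t$ for $0\le t<T$. -/

import Mathlib

open MeasureTheory ProbabilityTheory
open scoped ENNReal NNReal Gradient

noncomputable section

namespace AdaptiveClipping

/-! ### Differential privacy -/

/-- Sample-level add/remove adjacency: one of the two datasets is obtained from the other by adding
a single sample. Datasets are finite multisets of samples. -/
def Adjacent {Z : Type*} (D D' : Multiset Z) : Prop :=
  (∃ z, D' = z ::ₘ D) ∨ (∃ z, D = z ::ₘ D')

/-- `(ε, δ)`-differential privacy of a mechanism, given by its output law on each dataset. -/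
def IsDP {Z R : Type*} [MeasurableSpace R] (M : Multiset Z → Measure R) (ε δ : ℝ) : Prop :=
  ∀ D D' : Multiset Z, Adjacent D D' → ∀ A : Set R, MeasurableSet A →
    M D A ≤ ENNReal.ofReal (Real.exp ε) * M D' A + ENNReal.ofReal δ

/-! ### Privacy accountants -/

/-- One step of the Gaussian mechanism with sensitivity `1`, noise multiplier `σ` and Poisson
sampling rate `q`, on a dataset whose only sample contributes `1`: the law
`(1 - q) N(0, σ²) + q N(1, σ²)`. Without that sample the law is `N(0, σ²)`. -/
def subsampledGaussian (q σ : ℝ) : Measure ℝ :=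
  ENNReal.ofReal (1 - q) • gaussianReal 0 (σ ^ 2).toNNReal
    + ENNReal.ofReal q • gaussianReal 1 (σ ^ 2).toNNReal

/-- The law of `T` independent draws from `μ`. -/
def iterLaw (T : ℕ) (μ : Measure ℝ) : Measure (Fin T → ℝ) :=
  Measure.pi fun _ => μ

/-- The hockey-stick divergence of order `exp ε`, the supremum of `μ A - exp ε * ν A` over the
events `A`. -/
def hockeyStick {R : Type*} [MeasurableSpace R] (ε : ℝ) (μ ν : Measure R) : ℝ≥0∞ :=
  ⨆ (A : Set R) (_ : MeasurableSet A), μ A - ENNReal.ofReal (Real.exp ε) * ν A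

/-- The exact privacy profile `δ(ε)` of `T` steps of the Poisson-subsampled Gaussian mechanism with
sampling rate `q` and noise multiplier `σ`, over both directions (remove and add). -/
def privacyProfile (T : ℕ) (q σ ε : ℝ) : ℝ≥0∞ :=
  max
    (hockeyStick ε (iterLaw T (subsampledGaussian q σ))
      (iterLaw T (gaussianReal 0 (σ ^ 2).toNNReal)))
    (hockeyStick ε (iterLaw T (gaussianReal 0 (σ ^ 2).toNNReal))
      (iterLaw T (subsampledGaussian q σ)))

/-- The numerical (privacy-loss-distribution) accountant: it returns `(ε, δ)` when `δ` is an upper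
bound, tight or not, on the privacy profile at `ε`. -/
def ProfileAccountantReturns (T : ℕ) (q σ ε δ : ℝ) : Prop :=
  0 ≤ δ ∧ privacyProfile T q σ ε ≤ ENNReal.ofReal δ

/-- The Rényi divergence `(α - 1)⁻¹ log ∫ (dμ/dν)^α dν`, used below for `μ ≪ ν` and `1 < α`. -/
def renyiDiv {R : Type*} [MeasurableSpace R] (α : ℝ) (μ ν : Measure R) : EReal :=
  (((α - 1)⁻¹ : ℝ) : EReal) * ENNReal.log (∫⁻ x, (μ.rnDeriv ν x) ^ α ∂ν)

/-- The Rényi-DP parameter of order `α` of one step of the Poisson-subsampled Gaussian mechanism,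
over both directions (remove and add). -/
def stepRDP (q σ α : ℝ) : EReal :=
  max (renyiDiv α (subsampledGaussian q σ) (gaussianReal 0 (σ ^ 2).toNNReal))
    (renyiDiv α (gaussianReal 0 (σ ^ 2).toNNReal) (subsampledGaussian q σ))

/-- The Rényi-DP accountant: with a bound `ρ` on the per-step Rényi parameter of some order
`α > 1`, which adds up to `T * ρ` over the steps, it returns for the given `δ` the value
`T * ρ + log ((α - 1) / α) - (log δ + log α) / (α - 1)`, or anything larger. -/
def RDPAccountantReturns (T : ℕ) (q σ ε δ : ℝ) : Prop :=
  0 < δ ∧ ∃ α ρ : ℝ, 1 < α ∧ stepRDP q σ α ≤ (ρ : EReal) ∧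
    T * ρ + Real.log ((α - 1) / α) - (Real.log δ + Real.log α) / (α - 1) ≤ ε

/-- The noise multiplier `(σ₁⁻² + σ₂⁻²)^(-1/2)` of two Gaussian mechanisms together. -/
def effectiveNoise (σ₁ σ₂ : ℝ) : ℝ :=
  (σ₁ ^ (-2 : ℝ) + σ₂ ^ (-2 : ℝ)) ^ (-(1 / 2) : ℝ)

/-! ### DPSGD with adaptive clipping -/

/-- The two versions of the algorithm. -/
inductive Version
  | unbounded
  | lowerBounded

/-- The numerical inputs of the algorithm. -/
structure Params where
  /-- number of iterations -/
  T : ℕ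
  /-- public nominal size of the dataset -/
  N : ℕ
  /-- sampling rate -/
  q : ℝ
  /-- initial clipping bound -/
  C₀ : ℝ
  /-- noise multiplier for gradients -/
  σgrad : ℝ
  /-- noise multiplier for the clipped gradient count -/
  σcount : ℝ
  /-- learning rate of the clipping bound -/
  ηC : ℝ
  /-- threshold multiplier for counting clipped gradients -/
  τ : ℝ
  /-- target quantile -/
  γ : ℝ
  /-- lower bound of the clipping bound, ignored by the unbounded version -/
  CLB : ℝ
  /-- unbounded or lower-bounded adaptive clipping -/
  version : Version

/-- The expected batch size. -/
def Params.B (p : Params) : ℝ := p.q * p.N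

/-- The lower bound in force: `0` in the unbounded version. -/
def Params.lowerBound (p : Params) : ℝ :=
  match p.version with
  | .unbounded => 0
  | .lowerBounded => p.CLB

/-- Model parameters, with the Euclidean norm. -/
abbrev Param (d : ℕ) := EuclideanSpace ℝ (Fin d)

/-- State between iterations: internal state of the optimizer, model parameters `θ`, clipping
bound `C`. -/
abbrev State (S : Type*) (d : ℕ) := S × Param d × ℝ

/-- The noisy quantities of one iteration: the noisy gradient and the noisy fraction of large
gradients. -/
abbrev Release (d : ℕ) := Param d × ℝ

/-- Everything that a run of `n` iterations produces from the data: the state after the last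
iteration, and for each iteration the state at its start together with its noisy quantities. -/
abbrev Transcript (S : Type*) (d n : ℕ) := State S d × (Fin n → State S d × Release d)

/-- Poisson subsampling of `D` with rate `q`, followed by a mechanism `F` on the batch. Every
sub-multiset `b` of `D` (with multiplicity, so that the samples are kept independently of each other
with probability `q`) is the batch with probability `q ^ |b| * (1 - q) ^ (|D| - |b|)`. -/
def poissonSubsample {Z R : Type*} [MeasurableSpace R] (q : ℝ) (D : Multiset Z)
    (F : Multiset Z → Measure R) : Measure R :=
  (D.powerset.map fun b =>
    ENNReal.ofReal (q ^ b.card * (1 - q) ^ (D.card - b.card)) • F b).sum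

section Algorithm

variable {X Y O : Type*} {S : Type*} [MeasurableSpace S] {d : ℕ}

/-- The gradient `∇_θ L(f_θ(x), y)` of one sample `(x, y)`. At a point where the loss is not
differentiable it is `0` by convention. -/
def sampleGrad (f : Param d → X → O) (L : O → Y → ℝ) (θ : Param d) (z : X × Y) : Param d :=
  ∇ (fun θ' => L (f θ' z.1) z.2) θ

/-- Normalized clipping `g * min (1 / C, 1 / ‖g‖)`. A zero gradient stays zero. -/
def clip (C : ℝ) (g : Param d) : Param d := min (1 / C) (1 / ‖g‖) • g

/-- The sum of the clipped gradients of a batch. -/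
def clippedSum (f : Param d → X → O) (L : O → Y → ℝ) (θ : Param d) (C : ℝ)
    (b : Multiset (X × Y)) : Param d :=
  (b.map fun z => clip C (sampleGrad f L θ z)).sum

/-- The number of gradients of a batch with norm above `τ * C`. -/
def largeCount (f : Param d → X → O) (L : O → Y → ℝ) (τ : ℝ) (θ : Param d) (C : ℝ)
    (b : Multiset (X × Y)) : ℕ :=
  b.countP fun z => τ * C < ‖sampleGrad f L θ z‖

/-- The law of the noisy quantities of one iteration on a given batch: both Gaussian noises are
drawn independently. -/
def batchRelease (p : Params) (f : Param d → X → O) (L : O → Y → ℝ) (θ : Param d) (C : ℝ)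
    (b : Multiset (X × Y)) : Measure (Release d) :=
  ((multivariateGaussian (0 : Param d) (p.σgrad ^ 2 • (1 : Matrix (Fin d) (Fin d) ℝ))).prod
      (gaussianReal 0 (p.σcount ^ 2).toNNReal)).map fun w =>
    ((1 / p.B) • (clippedSum f L θ C b + w.1),
      (1 / p.B) * ((largeCount f L p.τ θ C b : ℝ) + w.2))

/-- The state after an iteration. -/
def nextState (p : Params) (opt : S × Param d → Param d → S × Param d)
    (s : State S d) (r : Release d) : State S d :=
  let u := opt (s.1, s.2.1) r.1
  (u.1, u.2, max p.lowerBound (s.2.2 * Real.exp (p.ηC * (r.2 - p.γ))))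

/-- The law of the transcript of the first `n` iterations on the dataset `D`. -/
def run (p : Params) (f : Param d → X → O) (L : O → Y → ℝ)
    (opt : S × Param d → Param d → S × Param d) (init : Measure (S × Param d))
    (D : Multiset (X × Y)) : (n : ℕ) → Measure (Transcript S d n)
  | 0 => init.map fun u => ((u.1, u.2, p.C₀), Fin.elim0)
  | n + 1 => (run p f L opt init D n).bind fun h =>
      (poissonSubsample p.q D (batchRelease p f L h.1.2.1 h.1.2.2)).map fun r =>
        (nextState p opt h.1 r, Fin.snoc (α := fun _ => State S d × Release d) h.2 (h.1, r))

/-- The algorithm, releasing its whole transcript. -/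
def fullRun (p : Params) (f : Param d → X → O) (L : O → Y → ℝ)
    (opt : S × Param d → Param d → S × Param d) (init : Measure (S × Param d))
    (D : Multiset (X × Y)) : Measure (Transcript S d p.T) :=
  run p f L opt init D p.T

/-- The algorithm, releasing only the final model parameters `θ_T`. -/
def finalModel (p : Params) (f : Param d → X → O) (L : O → Y → ℝ)
    (opt : S × Param d → Param d → S × Param d) (init : Measure (S × Param d))
    (D : Multiset (X × Y)) : Measure (Param d) :=
  (fullRun p f L opt init D).map fun h => h.1.2.1

end Algorithm

end AdaptiveClipping

end

noncomputable section

namespace AdaptiveClipping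

/-! ### From sets to tests -/

/-! The argument is an exact simulation. Fix a dataset and one extra sample `z`. Conditionally on
the past, a step adds Gaussian noise to a sum over the batch of pairs (clipped gradient, indicator),
and `z`, if kept, shifts this pair by a vector `v` whose two parts have size at most `1`. In units
of the noise, `v` has squared length at most `σgrad⁻² + σcount⁻² = σ⁻²`. Hence the joint noise has
room for an independent component `x • v` with `x` of law `N(0, σ²)`: after shrinking a fresh copy
of the noise along `v` and adding `x • v`, the original law is recovered (`map_simulate_zero`),
while `x` of mean `1` gives the noise shifted by `v` (`map_simulate_one`). The recipe does not look
at whether `z` was kept.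

Mixing over the kept and discarded cases, one Markov kernel sends `Q` to the step without `z` and
`P` to the step with `z` (`gaussianReal_bind_simulateStep`, `subsampledGaussian_bind_simulateStep`).
The kernel may depend on the past, in particular on the current clipping bound, so adaptivity costs
nothing: by induction a single kernel sends the products of `Q` and of `P` to the two transcript
laws (`exists_simulation`). Hockey-stick bounds pass through kernels (`bind_le_of_hockeyStick_le`),
which settles the profile accountant.

A Rényi bound is converted into a profile bound for the product laws (`hockeyStick_iterLaw_le`), by
multiplicativity of moments of the density and a tangent-line inequality. -/

/-- A bound on the hockey-stick divergence extends from events to `[0, 1]`-valued tests. -/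
theorem lintegral_le_of_hockeyStick_le {R : Type*} [MeasurableSpace R] {μ ν : Measure R}
    {ε δ : ℝ} (h : hockeyStick ε μ ν ≤ ENNReal.ofReal δ) {φ : R → ℝ≥0∞} (hφ : Measurable φ)
    (h1 : ∀ x, φ x ≤ 1) :
    ∫⁻ x, φ x ∂μ ≤ ENNReal.ofReal (Real.exp ε) * ∫⁻ x, φ x ∂ν + ENNReal.ofReal δ := by
  have hset : ∀ A : Set R, MeasurableSet A →
      μ A ≤ ENNReal.ofReal (Real.exp ε) * ν A + ENNReal.ofReal δ := fun A hA => by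
    rw [← tsub_le_iff_left]
    exact (le_iSup₂ (f := fun (A : Set R) (_ : MeasurableSet A) =>
      μ A - ENNReal.ofReal (Real.exp ε) * ν A) A hA).trans h
  set g : R → ℝ := fun x => (φ x).toReal with hg
  have hgm : Measurable g := hφ.ennreal_toReal
  have hφg : ∀ x, φ x = ENNReal.ofReal (g x) := fun x =>
    (ENNReal.ofReal_toReal (ne_top_of_le_ne_top ENNReal.one_ne_top (h1 x))).symm
  have hg1 : ∀ x, g x ≤ 1 := fun x => by
    simpa using ENNReal.toReal_mono ENNReal.one_ne_top (h1 x)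
  -- Layer-cake formula; levels above `1` contribute nothing because the test is at most `1`.
  have layer : ∀ ρ : Measure R, ∫⁻ x, φ x ∂ρ = ∫⁻ t in Set.Ioc (0 : ℝ) 1, ρ {x | t < g x} := by
    intro ρ
    simp_rw [hφg]
    rw [lintegral_eq_lintegral_meas_lt ρ (Filter.Eventually.of_forall fun x => by simp [hg])
      hgm.aemeasurable]
    rw [← Set.Ioc_union_Ioi_eq_Ioi (zero_le_one (α := ℝ)),
      lintegral_union measurableSet_Ioi (Set.Ioc_disjoint_Ioi le_rfl)]
    have : ∫⁻ t in Set.Ioi (1 : ℝ), ρ {x | t < g x} = 0 := by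
      rw [setLIntegral_congr_fun (g := fun _ => 0) measurableSet_Ioi]
      · simp
      · intro t ht
        have : {x | t < g x} = ∅ := by
          ext x
          simpa using (hg1 x).trans (le_of_lt ht)
        simp [this]
    rw [this, add_zero]
  have hmono : ∀ ρ : Measure R, Measurable fun t : ℝ => ρ {x | t < g x} := fun ρ =>
    Antitone.measurable fun s t hst => measure_mono fun x (hx : t < g x) => lt_of_le_of_lt hst hx
  rw [layer μ, layer ν, ← lintegral_const_mul _ (hmono ν)]
  calc ∫⁻ t in Set.Ioc (0 : ℝ) 1, μ {x | t < g x}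
      ≤ ∫⁻ t in Set.Ioc (0 : ℝ) 1,
          (ENNReal.ofReal (Real.exp ε) * ν {x | t < g x} + ENNReal.ofReal δ) :=
        lintegral_mono fun t => hset _ (hgm measurableSet_Ioi)
    -- The level interval has length `1`, so integrating the constant `δ` over it returns exactly
    -- `δ`.
    _ = _ := by
        rw [lintegral_add_right _ measurable_const]
        simp

/-- Post-processing: a bound on the hockey-stick divergence is inherited by the images under a
common Markov kernel. -/
theorem bind_le_of_hockeyStick_le {R R' : Type*} [MeasurableSpace R] [MeasurableSpace R']
    {μ ν : Measure R} {ε δ : ℝ} (h : hockeyStick ε μ ν ≤ ENNReal.ofReal δ)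
    {K : R → Measure R'} (hK : Measurable K) (hK1 : ∀ x, IsProbabilityMeasure (K x))
    {A : Set R'} (hA : MeasurableSet A) :
    μ.bind K A ≤ ENNReal.ofReal (Real.exp ε) * ν.bind K A + ENNReal.ofReal δ := by
  rw [Measure.bind_apply hA hK.aemeasurable, Measure.bind_apply hA hK.aemeasurable]
  exact lintegral_le_of_hockeyStick_le h (Measure.measurable_measure.1 hK A hA)
    fun x => prob_le_one

/-! ### The Rényi accountant is dominated by the privacy profile -/

/-- The tangent-line bound behind the conversion from Rényi to approximate differential privacy. -/
theorem sub_exp_le_mul_rpow {α ε r : ℝ} (hα : 1 < α) (hr : 0 ≤ r) :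
    r - Real.exp ε ≤
      Real.exp (-(α - 1) * ε + (α - 1) * Real.log ((α - 1) / α) - Real.log α) * r ^ α := by
  have hα0 : 0 < α := by linarith
  have hα1 : 0 < α - 1 := by linarith
  -- The maximizer of `(r - exp ε) / r ^ α`, i.e. the point where the line touches the optimal
  -- multiple of `r ^ α`. Bernoulli's inequality at `r / r₀` is the tangent-line bound there.
  set r₀ : ℝ := Real.exp ε * (α / (α - 1)) with hr₀
  have hr₀pos : 0 < r₀ := by positivity
  have hb := one_add_mul_self_le_rpow_one_add (s := r / r₀ - 1) (p := α)
    (by linarith [div_nonneg hr hr₀pos.le]) hα.le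
  rw [add_sub_cancel, Real.div_rpow hr hr₀pos.le] at hb
  have hlog : Real.log r₀ = ε - Real.log ((α - 1) / α) := by
    rw [hr₀, Real.log_mul (by positivity) (by positivity), Real.log_exp,
      ← inv_div, Real.log_inv]
    ring
  have hpow : r₀ ^ α = Real.exp (α * (ε - Real.log ((α - 1) / α))) := by
    rw [Real.rpow_def_of_pos hr₀pos, hlog, mul_comm]
  have hc : Real.exp (-(α - 1) * ε + (α - 1) * Real.log ((α - 1) / α) - Real.log α) * r₀ ^ α
      = Real.exp ε / (α - 1) := by
    rw [hpow, ← Real.exp_add]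
    have : -(α - 1) * ε + (α - 1) * Real.log ((α - 1) / α) - Real.log α +
        α * (ε - Real.log ((α - 1) / α)) = ε - Real.log (α - 1) := by
      rw [Real.log_div hα1.ne' hα0.ne']; ring
    rw [this, Real.exp_sub, Real.exp_log hα1]
  have hr₀α : 0 < r₀ ^ α := by positivity
  calc r - Real.exp ε = Real.exp ε / (α - 1) * (1 + α * (r / r₀ - 1)) := by
        rw [hr₀]; field_simp; ring
    _ ≤ Real.exp ε / (α - 1) * (r ^ α / r₀ ^ α) := by gcongr
    _ = _ := by rw [← hc]; field_simp

/-- A moment bound on the density gives a bound on the hockey-stick divergence. -/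
theorem hockeyStick_withDensity_le {R : Type*} [MeasurableSpace R] {ν : Measure R}
    {g : R → ℝ≥0∞} (hg : Measurable g) {α ε ρ δ : ℝ} (hα : 1 < α) (hδ : 0 < δ)
    (hI : ∫⁻ x, g x ^ α ∂ν ≤ ENNReal.ofReal (Real.exp ((α - 1) * ρ)))
    (hε : ρ + Real.log ((α - 1) / α) - (Real.log δ + Real.log α) / (α - 1) ≤ ε) :
    hockeyStick ε (ν.withDensity g) ν ≤ ENNReal.ofReal δ := by
  have hα1 : 0 < α - 1 := by linarith
  set c : ℝ := Real.exp (-(α - 1) * ε + (α - 1) * Real.log ((α - 1) / α) - Real.log α) with hc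
  have hpt : ∀ x, g x ≤ ENNReal.ofReal (Real.exp ε) + ENNReal.ofReal c * g x ^ α := by
    intro x
    -- The density may be infinite; then the right side is infinite too, as its coefficient is
    -- positive.
    by_cases hx : g x = ∞
    · rw [hx, ENNReal.top_rpow_of_pos (by linarith),
        ENNReal.mul_top (by simp [hc, Real.exp_pos])]
      simp
    · have h := sub_exp_le_mul_rpow (ε := ε) hα (ENNReal.toReal_nonneg (a := g x))
      rw [← ENNReal.ofReal_toReal hx, ENNReal.ofReal_rpow_of_nonneg ENNReal.toReal_nonneg
        (by linarith), ← ENNReal.ofReal_mul (Real.exp_pos _).le,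
        ← ENNReal.ofReal_add (Real.exp_pos _).le (by positivity)]
      exact ENNReal.ofReal_le_ofReal (by linarith)
  refine iSup₂_le fun A hA => ?_
  rw [tsub_le_iff_left, withDensity_apply _ hA]
  calc ∫⁻ x in A, g x ∂ν
      ≤ ∫⁻ x in A, (ENNReal.ofReal (Real.exp ε) + ENNReal.ofReal c * g x ^ α) ∂ν :=
        lintegral_mono hpt
    _ = ENNReal.ofReal (Real.exp ε) * ν A + ENNReal.ofReal c * ∫⁻ x in A, g x ^ α ∂ν := by
        rw [lintegral_add_left measurable_const, lintegral_const_mul _ (hg.pow_const α)]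
        simp
    _ ≤ ENNReal.ofReal (Real.exp ε) * ν A +
          ENNReal.ofReal c * ENNReal.ofReal (Real.exp ((α - 1) * ρ)) := by
        gcongr
        exact (setLIntegral_le_lintegral _ _).trans hI
    _ ≤ _ := by
        gcongr
        rw [← ENNReal.ofReal_mul (Real.exp_pos _).le, ← Real.exp_add]
        refine ENNReal.ofReal_le_ofReal ?_
        -- In logarithmic form the remaining claim is the assumption on `ε` multiplied by `α - 1`.
        rw [← Real.le_log_iff_exp_le hδ]
        have := mul_le_mul_of_nonneg_left hε hα1.le
        have h2 : (α - 1) * ((Real.log δ + Real.log α) / (α - 1)) = Real.log δ + Real.log α := by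
          field_simp
        rw [mul_sub, mul_add, h2] at this
        linarith

/-- The integral of a product of functions of the separate coordinates. -/
theorem lintegral_iterLaw_prod (μ : Measure ℝ) [IsProbabilityMeasure μ] :
    ∀ (n : ℕ) (g : Fin n → ℝ → ℝ≥0∞), (∀ i, Measurable (g i)) →
      ∫⁻ x, ∏ i, g i (x i) ∂(iterLaw n μ) = ∏ i, ∫⁻ y, g i y ∂μ
  | 0, g, _ => by simp [iterLaw]
  | n + 1, g, hg => by
    have h := (measurePreserving_piFinSuccAbove (fun _ : Fin (n + 1) => μ) 0).symm
    have hm : ∀ (m : ℕ) (k : Fin m → ℝ → ℝ≥0∞), (∀ i, Measurable (k i)) →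
        Measurable fun x : Fin m → ℝ => ∏ i, k i (x i) := fun m k hk =>
      Finset.measurable_fun_prod _ fun i _ => (hk i).comp (measurable_pi_apply i)
    have hm' := hm n (fun i => g i.succ) fun i => hg _
    have ih := lintegral_iterLaw_prod μ n (fun i => g i.succ) fun i => hg _
    rw [iterLaw] at ih ⊢
    rw [← h.lintegral_comp (hm (n + 1) g hg), Fin.prod_univ_succ, ← ih,
      ← lintegral_prod_mul (hg 0).aemeasurable hm'.aemeasurable]
    refine lintegral_congr fun x => ?_
    rw [Fin.prod_univ_succ]
    simp [MeasurableEquiv.piFinSuccAbove_symm_apply, Fin.insertNthEquiv]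

theorem iterLaw_withDensity (μ : Measure ℝ) [IsProbabilityMeasure μ] {g : ℝ → ℝ≥0∞}
    (hg : Measurable g) [IsProbabilityMeasure (μ.withDensity g)] (n : ℕ) :
    iterLaw n (μ.withDensity g) = (iterLaw n μ).withDensity fun x => ∏ i, g (x i) := by
  refine Measure.pi_eq fun s hs => ?_
  rw [withDensity_apply _ (MeasurableSet.univ_pi hs),
    ← lintegral_indicator (MeasurableSet.univ_pi hs)]
  -- The indicator of a box is the product of the indicators of its sides, so the integral
  -- factorizes; boxes determine the product measure.
  have : ∀ x : Fin n → ℝ, (Set.univ.pi s).indicator (fun x => ∏ i, g (x i)) x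
      = ∏ i, (s i).indicator g (x i) := by
    intro x
    by_cases hx : x ∈ Set.univ.pi s
    · rw [Set.indicator_of_mem hx]
      exact Finset.prod_congr rfl fun i _ => (Set.indicator_of_mem (hx i trivial) _).symm
    · rw [Set.indicator_of_notMem hx]
      simp only [Set.mem_univ_pi, not_forall] at hx
      obtain ⟨i, hi⟩ := hx
      exact (Finset.prod_eq_zero (Finset.mem_univ i) (Set.indicator_of_notMem hi _)).symm
  simp_rw [this]
  rw [lintegral_iterLaw_prod μ n _ fun i => hg.indicator (hs i)]
  exact Finset.prod_congr rfl fun i _ => by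
    rw [withDensity_apply _ (hs i), lintegral_indicator (hs i)]

/-- The extended logarithm is an order embedding, so it can be undone after clearing the positive
factor `α - 1`, with no separate treatment of a zero or infinite moment. -/
theorem lintegral_rpow_le_of_renyiDiv_le {R : Type*} [MeasurableSpace R] {α ρ : ℝ} (hα : 1 < α)
    {μ ν : Measure R} (h : renyiDiv α μ ν ≤ (ρ : EReal)) :
    ∫⁻ x, μ.rnDeriv ν x ^ α ∂ν ≤ ENNReal.ofReal (Real.exp ((α - 1) * ρ)) := by
  have hα1 : 0 < α - 1 := by linarith
  rw [renyiDiv] at h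
  have h' := mul_le_mul_of_nonneg_left h (EReal.coe_nonneg.2 hα1.le)
  rw [← mul_assoc, ← EReal.coe_mul, mul_inv_cancel₀ hα1.ne', EReal.coe_one, one_mul,
    ← EReal.coe_mul] at h'
  rw [← ENNReal.log_le_log_iff]
  refine h'.trans (le_of_eq ?_)
  rw [ENNReal.log_ofReal_of_pos (Real.exp_pos _), Real.log_exp]

/-- Composition and conversion of Rényi bounds. -/
theorem hockeyStick_iterLaw_le {μ ν : Measure ℝ} [IsProbabilityMeasure μ] [IsProbabilityMeasure ν]
    (hμν : μ ≪ ν) {α ρ ε δ : ℝ} (T : ℕ) (hα : 1 < α) (hδ : 0 < δ)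
    (h : renyiDiv α μ ν ≤ (ρ : EReal))
    (hε : T * ρ + Real.log ((α - 1) / α) - (Real.log δ + Real.log α) / (α - 1) ≤ ε) :
    hockeyStick ε (iterLaw T μ) (iterLaw T ν) ≤ ENNReal.ofReal δ := by
  have hd : ν.withDensity (μ.rnDeriv ν) = μ := Measure.withDensity_rnDeriv_eq μ ν hμν
  have hgm := Measure.measurable_rnDeriv μ ν
  have : IsProbabilityMeasure (ν.withDensity (μ.rnDeriv ν)) := by rw [hd]; infer_instance
  have : IsProbabilityMeasure (iterLaw T ν) := by unfold iterLaw; infer_instance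
  have key := iterLaw_withDensity ν hgm T
  rw [hd] at key
  rw [key]
  refine hockeyStick_withDensity_le (by fun_prop) hα hδ ?_ hε
  -- The moment of the product density is the `T`-th power of the one-step moment; this is the
  -- additivity of Rényi bounds.
  simp_rw [← ENNReal.prod_rpow_of_nonneg (show 0 ≤ α by linarith)]
  rw [lintegral_iterLaw_prod ν T (fun _ y => μ.rnDeriv ν y ^ α) fun _ => hgm.pow_const α]
  rw [Finset.prod_const, Finset.card_univ, Fintype.card_fin,
    show (α - 1) * (T * ρ) = T * ((α - 1) * ρ) by ring, Real.exp_nat_mul,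
    ENNReal.ofReal_pow (Real.exp_pos _).le]
  gcongr
  exact lintegral_rpow_le_of_renyiDiv_le hα h

theorem isProbabilityMeasure_subsampledGaussian {q : ℝ} (hq : 0 ≤ q) (hq1 : q ≤ 1) (σ : ℝ) :
    IsProbabilityMeasure (subsampledGaussian q σ) := by
  refine ⟨?_⟩
  rw [subsampledGaussian, Measure.add_apply, Measure.smul_apply, Measure.smul_apply]
  simp only [measure_univ, smul_eq_mul, mul_one]
  rw [← ENNReal.ofReal_add (by linarith) hq]
  simp

theorem subsampledGaussian_absolutelyContinuous (q : ℝ) {σ : ℝ} (hσ : 0 < σ) :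
    subsampledGaussian q σ ≪ gaussianReal 0 (σ ^ 2).toNNReal := by
  have hv : (σ ^ 2).toNNReal ≠ 0 := by simpa using hσ.ne'
  refine Measure.AbsolutelyContinuous.mk fun s _ hs => ?_
  have h1 : gaussianReal 1 (σ ^ 2).toNNReal s = 0 :=
    gaussianReal_absolutelyContinuous _ hv (gaussianReal_absolutelyContinuous' _ hv hs)
  simp [subsampledGaussian, hs, h1]

/-- The shifted component alone suffices, since its weight `q` is positive and nondegenerate
Gaussians share their null sets. This covers `q = 1`, where the unshifted component is absent. -/
theorem absolutelyContinuous_subsampledGaussian {q : ℝ} (hq : 0 < q) {σ : ℝ} (hσ : 0 < σ) :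
    gaussianReal 0 (σ ^ 2).toNNReal ≪ subsampledGaussian q σ := by
  have hv : (σ ^ 2).toNNReal ≠ 0 := by simpa using hσ.ne'
  refine Measure.AbsolutelyContinuous.mk fun s _ hs => ?_
  simp only [subsampledGaussian, Measure.add_apply, Measure.smul_apply, smul_eq_mul,
    add_eq_zero, mul_eq_zero, ENNReal.ofReal_eq_zero, not_le.2 hq, false_or] at hs
  exact gaussianReal_absolutelyContinuous _ hv (gaussianReal_absolutelyContinuous' _ hv hs.2)

/-- Whatever an accountant returns bounds the privacy profile. -/
theorem privacyProfile_le_of_accountant {T : ℕ} {q σ ε δ : ℝ} (hq : 0 < q) (hq1 : q ≤ 1)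
    (hσ : 0 < σ) (h : ProfileAccountantReturns T q σ ε δ ∨ RDPAccountantReturns T q σ ε δ) :
    privacyProfile T q σ ε ≤ ENNReal.ofReal δ := by
  rcases h with h | ⟨hδ, α, ρ, hα, hρ, hε⟩
  · exact h.2
  · have := isProbabilityMeasure_subsampledGaussian hq.le hq1 σ
    exact max_le
      (hockeyStick_iterLaw_le (subsampledGaussian_absolutelyContinuous q hσ) T hα hδ
        ((le_max_left _ _).trans hρ) hε)
      (hockeyStick_iterLaw_le (absolutelyContinuous_subsampledGaussian hq hσ) T hα hδ
        ((le_max_right _ _).trans hρ) hε)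

/-! ### One Gaussian step as a post-processing of a one-dimensional Gaussian -/

section Noise

open scoped RealInnerProductSpace

variable {d : ℕ}

/-- The joint law of the gradient noise and the count noise. -/
def jointNoise (d : ℕ) (σ₁ σ₂ : ℝ) : Measure (Release d) :=
  (multivariateGaussian (0 : Param d) (σ₁ ^ 2 • (1 : Matrix (Fin d) (Fin d) ℝ))).prod
    (gaussianReal 0 (σ₂ ^ 2).toNNReal)

instance (σ₁ σ₂ : ℝ) : IsProbabilityMeasure (jointNoise d σ₁ σ₂) := by
  unfold jointNoise; infer_instance

/-- Riesz representation on the Euclidean factor; it makes characteristic functions on the product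
explicit. -/
theorem exists_coeff_strongDual (L : StrongDual ℝ (Release d)) :
    ∃ (a : Param d) (l : ℝ), ∀ w, L w = ⟪a, w.1⟫ + l * w.2 := by
  refine ⟨(InnerProductSpace.toDual ℝ (Param d)).symm (L.comp (.inl ℝ (Param d) ℝ)), L (0, 1),
    fun w => ?_⟩
  rw [InnerProductSpace.toDual_symm_apply, mul_comm, ← smul_eq_mul, ← map_smul]
  simp [← map_add]

theorem charFunDual_jointNoise (σ₁ σ₂ : ℝ) (L : StrongDual ℝ (Release d)) {a : Param d} {l : ℝ}
    (hL : ∀ w, L w = ⟪a, w.1⟫ + l * w.2) :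
    charFunDual (jointNoise d σ₁ σ₂) L
      = Complex.exp (-(σ₁ ^ 2 * ‖a‖ ^ 2 + σ₂ ^ 2 * l ^ 2 : ℝ) / 2) := by
  have hps : (σ₁ ^ 2 • (1 : Matrix (Fin d) (Fin d) ℝ)).PosSemidef :=
    Matrix.PosSemidef.one.smul (sq_nonneg σ₁)
  have hsplit : ∀ w : Release d, Complex.exp (L w * Complex.I)
      = Complex.exp (⟪w.1, a⟫ * Complex.I) * Complex.exp (l * w.2 * Complex.I) := fun w => by
    rw [hL, ← Complex.exp_add, real_inner_comm]
    push_cast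
    ring_nf
  rw [charFunDual_apply]
  simp_rw [hsplit]
  rw [jointNoise, integral_prod_mul (fun x : Param d => Complex.exp (⟪x, a⟫ * Complex.I))
    (fun y : ℝ => Complex.exp (l * y * Complex.I)), ← charFun_apply, ← charFun_apply_real,
    charFun_multivariateGaussian hps, charFun_gaussianReal, ← Complex.exp_add]
  congr 1
  have hdot : (a.ofLp ⬝ᵥ a.ofLp) = ‖a‖ ^ 2 := by
    rw [EuclideanSpace.real_norm_sq_eq, dotProduct]
    exact Finset.sum_congr rfl fun i _ => (sq _).symm
  rw [Matrix.smul_mulVec, Matrix.one_mulVec, dotProduct_smul, hdot, Real.coe_toNNReal _ (sq_nonneg _)]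
  simp only [inner_zero_right, smul_eq_mul]
  push_cast
  ring

/-- The squared norm of a shift, measured in units of the noise. -/
def noiseNormSq (σ₁ σ₂ : ℝ) (v : Release d) : ℝ :=
  ‖v.1‖ ^ 2 / σ₁ ^ 2 + v.2 ^ 2 / σ₂ ^ 2

/-- The coefficient by which the component of the noise along a shift has to be shrunk in order to
make room for a one-dimensional noise of standard deviation `σ`. -/
def shrinkCoeff (σ₁ σ₂ σ : ℝ) (v : Release d) : ℝ :=
  σ ^ 2 / (1 + √(1 - noiseNormSq σ₁ σ₂ v * σ ^ 2))

/-- The simulation of the noise `w` shifted along `v`, from a one-dimensional output `x` and a fresh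
noise `w`. -/
def simulate (σ₁ σ₂ σ : ℝ) (v : Release d) (x : ℝ) (w : Release d) : Release d :=
  x • v + (w - (shrinkCoeff σ₁ σ₂ σ v * (⟪v.1, w.1⟫ / σ₁ ^ 2 + v.2 * w.2 / σ₂ ^ 2)) • v)

/-- Shrinking with coefficient `s` removes `(2 * s - s ^ 2 * κ) • v vᵀ` from the covariance, where
`κ` is the squared length of `v` in noise units. This must equal the `σ ^ 2 • v vᵀ` that `x • v`
puts back. The quadratic has a real root because `κ * σ ^ 2 ≤ 1`; the rationalized form of the
smaller root also makes sense at `κ = 0`. -/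
theorem shrinkCoeff_spec {σ₁ σ₂ σ : ℝ} {v : Release d} (hv : noiseNormSq σ₁ σ₂ v * σ ^ 2 ≤ 1) :
    2 * shrinkCoeff σ₁ σ₂ σ v - shrinkCoeff σ₁ σ₂ σ v ^ 2 * noiseNormSq σ₁ σ₂ v = σ ^ 2 := by
  have hr := Real.sq_sqrt (sub_nonneg.2 hv)
  have hr0 := Real.sqrt_nonneg (1 - noiseNormSq σ₁ σ₂ v * σ ^ 2)
  rw [shrinkCoeff]
  set r := √(1 - noiseNormSq σ₁ σ₂ v * σ ^ 2)
  have h1 : 1 + r ≠ 0 := by positivity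
  field_simp
  linear_combination -σ ^ 2 * hr

theorem measurable_simulate (σ₁ σ₂ σ : ℝ) :
    Measurable fun u : Release d × ℝ × Release d => simulate σ₁ σ₂ σ u.1 u.2.1 u.2.2 := by
  unfold simulate shrinkCoeff noiseNormSq
  fun_prop

/-- `simulate` as a continuous linear map. -/
def simulateCLM (σ₁ σ₂ σ : ℝ) (v : Release d) : ℝ × Release d →L[ℝ] Release d :=
  LinearMap.toContinuousLinearMap
    { toFun := fun u => simulate σ₁ σ₂ σ v u.1 u.2
      map_add' := fun u u' => by
        ext <;> simp [simulate, inner_add_right] <;> ring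
      map_smul' := fun c u => by
        ext <;> simp [simulate, inner_smul_right] <;> ring }

/-- The image is again a centred Gaussian, so only covariances matter: what the shrinking removes
along `v` is what `x • v` restores. The comparison is made on characteristic functions, one
functional `L` at a time. -/
theorem map_simulate_zero {σ₁ σ₂ σ : ℝ} (h₁ : σ₁ ≠ 0) (h₂ : σ₂ ≠ 0) {v : Release d}
    (hv : noiseNormSq σ₁ σ₂ v * σ ^ 2 ≤ 1) :
    ((gaussianReal 0 (σ ^ 2).toNNReal).prod (jointNoise d σ₁ σ₂)).map
      (fun u => simulate σ₁ σ₂ σ v u.1 u.2) = jointNoise d σ₁ σ₂ := by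
  change Measure.map (simulateCLM σ₁ σ₂ σ v) _ = _
  have : IsProbabilityMeasure (((gaussianReal 0 (σ ^ 2).toNNReal).prod (jointNoise d σ₁ σ₂)).map
      (simulateCLM σ₁ σ₂ σ v)) :=
    Measure.isProbabilityMeasure_map (simulateCLM σ₁ σ₂ σ v).continuous.measurable.aemeasurable
  refine Measure.ext_of_charFunDual (funext fun L => ?_)
  obtain ⟨a, l, hL⟩ := exists_coeff_strongDual L
  set s := shrinkCoeff σ₁ σ₂ σ v with hs
  have hspec := shrinkCoeff_spec hv
  rw [← hs] at hspec
  -- Pulled back to the noise factor, `L` loses a multiple of `L v` in the direction dual to `v`; on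
  -- the scalar factor it is multiplication by `L v`.
  have hL' : ∀ w, ((L.comp (simulateCLM σ₁ σ₂ σ v)).comp (.inr ℝ ℝ (Release d))) w
      = ⟪a - (s * L v / σ₁ ^ 2) • v.1, w.1⟫ + (l - s * L v * v.2 / σ₂ ^ 2) * w.2 := fun w => by
    change L (simulate σ₁ σ₂ σ v 0 w) = _
    rw [simulate, zero_smul, zero_add, map_sub, map_smul, hL w, ← hs, inner_sub_left,
      real_inner_smul_left, smul_eq_mul]
    ring
  have hx : ((L.comp (simulateCLM σ₁ σ₂ σ v)).comp (.inl ℝ ℝ (Release d))) 1 = L v := by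
    change L (simulate σ₁ σ₂ σ v 1 0) = _
    simp [simulate]
  rw [charFunDual_map, charFunDual_prod, charFunDual_jointNoise σ₁ σ₂ _ hL',
    charFunDual_jointNoise σ₁ σ₂ L hL, charFunDual_eq_charFun_map_one]
  have hmap : (gaussianReal 0 (σ ^ 2).toNNReal).map
      ((L.comp (simulateCLM σ₁ σ₂ σ v)).comp (.inl ℝ ℝ (Release d)))
      = gaussianReal 0 (((L v) ^ 2).toNNReal * (σ ^ 2).toNNReal) := by
    have : ⇑((L.comp (simulateCLM σ₁ σ₂ σ v)).comp (.inl ℝ ℝ (Release d))) = fun x => L v * x := by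
      funext x
      rw [← hx, mul_comm, ← smul_eq_mul, ← map_smul, smul_eq_mul, mul_one]
    rw [this, gaussianReal_map_const_mul, mul_zero]
    congr 2
    ext
    simp [sq_nonneg]
  rw [hmap, charFun_gaussianReal, ← Complex.exp_add]
  congr 1
  have hnorm : ‖a - (s * L v / σ₁ ^ 2) • v.1‖ ^ 2
      = ‖a‖ ^ 2 - 2 * (s * L v / σ₁ ^ 2) * ⟪a, v.1⟫ + (s * L v / σ₁ ^ 2) ^ 2 * ‖v.1‖ ^ 2 := by
    rw [norm_sub_sq_real, real_inner_smul_right, norm_smul, mul_pow, Real.norm_eq_abs, sq_abs]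
    ring
  -- The variance of `L` under the simulation against its variance under the noise; the defect is
  -- `(L v) ^ 2` times the quadratic equation for `s`.
  have key : σ₁ ^ 2 * ‖a - (s * L v / σ₁ ^ 2) • v.1‖ ^ 2
      + σ₂ ^ 2 * (l - s * L v * v.2 / σ₂ ^ 2) ^ 2 + (L v) ^ 2 * σ ^ 2
      = σ₁ ^ 2 * ‖a‖ ^ 2 + σ₂ ^ 2 * l ^ 2 := by
    have e1 : σ₁ ^ 2 * ‖a - (s * L v / σ₁ ^ 2) • v.1‖ ^ 2
        + σ₂ ^ 2 * (l - s * L v * v.2 / σ₂ ^ 2) ^ 2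
        = σ₁ ^ 2 * ‖a‖ ^ 2 + σ₂ ^ 2 * l ^ 2 - 2 * s * L v * (⟪a, v.1⟫ + l * v.2)
          + s ^ 2 * (L v) ^ 2 * noiseNormSq σ₁ σ₂ v := by
      rw [hnorm, noiseNormSq]
      field_simp
      ring
    rw [e1, ← hL v]
    linear_combination -(L v) ^ 2 * hspec
  rw [← key]
  rw [NNReal.coe_mul, Real.coe_toNNReal _ (sq_nonneg _), Real.coe_toNNReal _ (sq_nonneg _)]
  push_cast
  ring

/-- Raising `x` by `1` adds exactly `v` to the output, so this is the centred case translated. -/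
theorem map_simulate_one {σ₁ σ₂ σ : ℝ} (h₁ : σ₁ ≠ 0) (h₂ : σ₂ ≠ 0) {v : Release d}
    (hv : noiseNormSq σ₁ σ₂ v * σ ^ 2 ≤ 1) :
    ((gaussianReal 1 (σ ^ 2).toNNReal).prod (jointNoise d σ₁ σ₂)).map
      (fun u => simulate σ₁ σ₂ σ v u.1 u.2) = (jointNoise d σ₁ σ₂).map (v + ·) := by
  have hm : Measurable fun u : ℝ × Release d => simulate σ₁ σ₂ σ v u.1 u.2 :=
    (measurable_simulate σ₁ σ₂ σ).comp measurable_prodMk_left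
  have hg : gaussianReal 1 (σ ^ 2).toNNReal = (gaussianReal 0 (σ ^ 2).toNNReal).map (1 + ·) := by
    rw [gaussianReal_map_const_add, zero_add]
  have hprod : (gaussianReal 1 (σ ^ 2).toNNReal).prod (jointNoise d σ₁ σ₂)
      = ((gaussianReal 0 (σ ^ 2).toNNReal).prod (jointNoise d σ₁ σ₂)).map (Prod.map (1 + ·) id) := by
    rw [hg, ← Measure.map_prod_map _ _ (by fun_prop) measurable_id, Measure.map_id]
  rw [hprod, Measure.map_map hm (by fun_prop)]
  conv_rhs => rw [← map_simulate_zero h₁ h₂ hv, Measure.map_map (by fun_prop) hm]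
  congr 1
  funext u
  simp [simulate, add_smul, add_assoc]

theorem effectiveNoise_pos {σ₁ σ₂ : ℝ} (h₁ : 0 < σ₁) (h₂ : 0 < σ₂) : 0 < effectiveNoise σ₁ σ₂ := by
  unfold effectiveNoise; positivity

theorem effectiveNoise_sq {σ₁ σ₂ : ℝ} (h₁ : 0 < σ₁) (h₂ : 0 < σ₂) :
    effectiveNoise σ₁ σ₂ ^ 2 = (1 / σ₁ ^ 2 + 1 / σ₂ ^ 2)⁻¹ := by
  have e : ∀ x : ℝ, 0 < x → x ^ (-2 : ℝ) = 1 / x ^ 2 := fun x hx => by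
    rw [Real.rpow_neg hx.le, one_div]; norm_cast
  rw [effectiveNoise, e _ h₁, e _ h₂, ← Real.rpow_natCast, ← Real.rpow_mul (by positivity)]
  norm_num [Real.rpow_neg_one]

/-- A shift with a gradient part of norm at most `1` and a count part of size at most `1` is within
reach of the one-dimensional mechanism with the effective noise. -/
theorem noiseNormSq_mul_effectiveNoise_le {σ₁ σ₂ : ℝ} (h₁ : 0 < σ₁) (h₂ : 0 < σ₂)
    {v : Release d} (hv₁ : ‖v.1‖ ≤ 1) (hv₂ : |v.2| ≤ 1) :
    noiseNormSq σ₁ σ₂ v * effectiveNoise σ₁ σ₂ ^ 2 ≤ 1 := by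
  rw [effectiveNoise_sq h₁ h₂, ← div_eq_mul_inv, div_le_one (by positivity), noiseNormSq]
  gcongr
  · exact pow_le_one₀ (norm_nonneg _) hv₁
  · exact (sq_le_one_iff_abs_le_one _).2 hv₂

end Noise

/-! ### Measurable families of measures -/

section Families

variable {α β γ : Type*} [MeasurableSpace α] [MeasurableSpace β] [MeasurableSpace γ]

theorem measurable_map_family {κ : α → Measure β} (hκ : Measurable κ)
    (hκ1 : ∀ a, IsProbabilityMeasure (κ a)) {g : α × β → γ} (hg : Measurable g) :
    Measurable fun a => (κ a).map fun b => g (a, b) := by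
  let k : Kernel α β := ⟨κ, hκ⟩
  have : IsMarkovKernel k := ⟨hκ1⟩
  refine Measure.measurable_of_measurable_coe _ fun s hs => ?_
  have : ∀ a, (κ a).map (fun b => g (a, b)) s = k a (Prod.mk a ⁻¹' (g ⁻¹' s)) := fun a =>
    Measure.map_apply (hg.comp measurable_prodMk_left) hs
  simp_rw [this]
  exact Kernel.measurable_kernel_prodMk_left (hg hs)

theorem measurable_bind_family {κ : α → Measure β} (hκ : Measurable κ)
    (hκ1 : ∀ a, IsProbabilityMeasure (κ a)) {η : α × β → Measure γ} (hη : Measurable η) :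
    Measurable fun a => (κ a).bind fun b => η (a, b) := by
  let k : Kernel α β := ⟨κ, hκ⟩
  have : IsMarkovKernel k := ⟨hκ1⟩
  refine Measure.measurable_of_measurable_coe _ fun s hs => ?_
  have : ∀ a, (κ a).bind (fun b => η (a, b)) s = ∫⁻ b, η (a, b) s ∂(k a) := fun a =>
    Measure.bind_apply hs (hη.comp measurable_prodMk_left).aemeasurable
  simp_rw [this]
  exact Measurable.lintegral_kernel_prod_right' ((Measure.measurable_coe hs).comp hη)

theorem isProbabilityMeasure_bind_family {μ : Measure α} [IsProbabilityMeasure μ]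
    {κ : α → Measure β} (hκ : Measurable κ) (hκ1 : ∀ a, IsProbabilityMeasure (κ a)) :
    IsProbabilityMeasure (μ.bind κ) :=
  ⟨by simp [Measure.bind_apply MeasurableSet.univ hκ.aemeasurable]⟩

theorem add_smul_bind (a b : ℝ≥0∞) (μ ν : Measure α) {κ : α → Measure β} (hκ : Measurable κ) :
    (a • μ + b • ν).bind κ = a • μ.bind κ + b • ν.bind κ := by
  ext s hs
  simp [Measure.bind_apply hs hκ.aemeasurable, lintegral_add_measure, lintegral_smul_measure]

theorem map_bind_family {μ : Measure α} {κ : α → Measure β} (hκ : Measurable κ) {g : β → γ}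
    (hg : Measurable g) : (μ.bind κ).map g = μ.bind fun a => (κ a).map g := by
  have hm : Measurable fun a => (κ a).map g := (Measure.measurable_map g hg).comp hκ
  ext s hs
  rw [Measure.map_apply hg hs, Measure.bind_apply (hg hs) hκ.aemeasurable,
    Measure.bind_apply hs hm.aemeasurable]
  simp_rw [Measure.map_apply hg hs]

theorem bind_map_family {μ : Measure α} {ν : Measure β} [IsProbabilityMeasure ν]
    {g : α × β → γ} (hg : Measurable g) :
    μ.bind (fun a => ν.map fun b => g (a, b)) = (μ.prod ν).map g := by
  ext s hs
  rw [Measure.bind_apply hs (measurable_map_family measurable_const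
      (fun _ => inferInstance) hg).aemeasurable, Measure.map_apply hg hs,
    Measure.prod_apply (hg hs)]
  exact lintegral_congr fun a => Measure.map_apply (hg.comp measurable_prodMk_left) hs

end Families

/-! ### Poisson subsampling -/

section Poisson

variable {Z R α : Type*} [MeasurableSpace R] [MeasurableSpace α]

/-- Conditioning on whether `z` is kept; the sub-multisets of the enlarged dataset split
accordingly. -/
theorem poissonSubsample_cons {q : ℝ} (hq : 0 ≤ q) (hq1 : q ≤ 1) (z : Z) (D : Multiset Z)
    (F : Multiset Z → Measure R) :
    poissonSubsample q (z ::ₘ D) F = ENNReal.ofReal (1 - q) • poissonSubsample q D F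
      + ENNReal.ofReal q • poissonSubsample q D fun b => F (z ::ₘ b) := by
  have h1 : 0 ≤ 1 - q := sub_nonneg.2 hq1
  simp only [poissonSubsample, Multiset.powerset_cons, Multiset.map_add, Multiset.sum_add,
    Multiset.smul_sum, Multiset.map_map, Function.comp_def, Multiset.card_cons,
    Nat.add_sub_add_right, smul_smul]
  congr 2
  · refine Multiset.map_congr rfl fun b hb => ?_
    -- Needed for the truncated subtraction: only for `|b| ≤ |D|` does the larger dataset yield one
    -- more factor `1 - q`.
    have hb := Multiset.card_le_card (Multiset.mem_powerset.1 hb)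
    rw [← ENNReal.ofReal_mul h1, Nat.sub_add_comm hb, pow_succ]
    ring_nf
  · refine Multiset.map_congr rfl fun b _ => ?_
    rw [← ENNReal.ofReal_mul hq, pow_succ]
    ring_nf

theorem isProbabilityMeasure_poissonSubsample {q : ℝ} (hq : 0 ≤ q) (hq1 : q ≤ 1)
    (D : Multiset Z) {F : Multiset Z → Measure R} (hF : ∀ b, IsProbabilityMeasure (F b)) :
    IsProbabilityMeasure (poissonSubsample q D F) := by
  induction D using Multiset.induction generalizing F with
  | empty => simpa [poissonSubsample] using hF 0
  | cons z D ih =>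
    have h0 := ih hF
    have h1 := ih fun b => hF (z ::ₘ b)
    rw [poissonSubsample_cons hq hq1]
    refine ⟨?_⟩
    simp [← ENNReal.ofReal_add (sub_nonneg.2 hq1) hq]

theorem measurable_poissonSubsample (q : ℝ) (D : Multiset Z) {G : α → Multiset Z → Measure R}
    (hG : ∀ b, Measurable fun a => G a b) :
    Measurable fun a => poissonSubsample q D (G a) := by
  unfold poissonSubsample
  generalize D.powerset = s
  induction s using Multiset.induction with
  | empty => simp
  | cons b s ih =>
    simp only [Multiset.map_cons, Multiset.sum_cons]
    refine Measurable.add ?_ ih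
    refine Measure.measurable_of_measurable_coe _ fun t ht => ?_
    simp only [Measure.smul_apply, smul_eq_mul]
    exact ((Measure.measurable_coe ht).comp (hG b)).const_mul _

/-- Subsampling is a finite weighted sum, and `bind` is linear in the kernel. -/
theorem bind_poissonSubsample (q : ℝ) (D : Multiset Z) (μ : Measure α)
    {G : α → Multiset Z → Measure R} (hG : ∀ b, Measurable fun a => G a b) :
    μ.bind (fun a => poissonSubsample q D (G a))
      = poissonSubsample q D fun b => μ.bind fun a => G a b := by
  ext t ht
  have hm := measurable_poissonSubsample q D hG
  rw [Measure.bind_apply ht hm.aemeasurable]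
  unfold poissonSubsample
  generalize D.powerset = s
  induction s using Multiset.induction with
  | empty => simp
  | cons b s ih =>
    have hb : Measurable fun a => G a b t := (Measure.measurable_coe ht).comp (hG b)
    simp only [Multiset.map_cons, Multiset.sum_cons, Measure.add_apply, Measure.smul_apply,
      smul_eq_mul]
    rw [lintegral_add_left (hb.const_mul _), lintegral_const_mul _ hb, ih,
      Measure.bind_apply ht (hG b).aemeasurable]

end Poisson

/-! ### One iteration -/

section Step

variable {X Y O : Type*} {d : ℕ} (f : Param d → X → O) (L : O → Y → ℝ)

/-- The derivative of an arbitrary function, set to zero where it does not exist, is measurable, so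
no regularity of the loss or the model is needed. -/
theorem measurable_sampleGrad (z : X × Y) : Measurable fun θ => sampleGrad f L θ z :=
  (InnerProductSpace.toDual ℝ (Param d)).symm.continuous.measurable.comp
    (measurable_fderiv ℝ fun θ' => L (f θ' z.1) z.2)

/-- The contribution of one sample to the sum of the clipped gradients and to the count. -/
def contribution (τ : ℝ) (u : Param d × ℝ) (z : X × Y) : Release d :=
  (clip u.2 (sampleGrad f L u.1 z), if τ * u.2 < ‖sampleGrad f L u.1 z‖ then 1 else 0)

theorem measurable_contribution (τ : ℝ) (z : X × Y) :
    Measurable fun u : Param d × ℝ => contribution f L τ u z := by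
  have hg : Measurable fun u : Param d × ℝ => sampleGrad f L u.1 z :=
    (measurable_sampleGrad f L z).comp measurable_fst
  refine Measurable.prodMk ?_ (Measurable.ite ?_ measurable_const measurable_const)
  · unfold clip
    fun_prop
  · exact measurableSet_lt (by fun_prop) hg.norm

theorem norm_clip_le {C : ℝ} (hC : 0 < C) (g : Param d) : ‖clip C g‖ ≤ 1 := by
  have h0 : 0 ≤ min (1 / C) (1 / ‖g‖) := by positivity
  rw [clip, norm_smul, Real.norm_of_nonneg h0]
  calc min (1 / C) (1 / ‖g‖) * ‖g‖ ≤ 1 / ‖g‖ * ‖g‖ := by gcongr; exact min_le_right _ _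
    _ ≤ 1 := by rw [one_div]; exact inv_mul_le_one

/-- The noiseless sum of clipped gradients and count of a batch. -/
def batchMean (τ : ℝ) (u : Param d × ℝ) (b : Multiset (X × Y)) : Release d :=
  (b.map (contribution f L τ u)).sum

theorem batchMean_eq (τ : ℝ) (u : Param d × ℝ) (b : Multiset (X × Y)) :
    batchMean f L τ u b = (clippedSum f L u.1 u.2 b, (largeCount f L τ u.1 u.2 b : ℝ)) := by
  unfold batchMean clippedSum largeCount
  induction b using Multiset.induction with
  | empty => simp; rfl
  | cons z b ih =>
    rw [Multiset.map_cons, Multiset.sum_cons, ih, Multiset.countP_cons]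
    ext <;> simp [contribution, add_comm]

theorem measurable_batchMean (τ : ℝ) (b : Multiset (X × Y)) :
    Measurable fun u : Param d × ℝ => batchMean f L τ u b := by
  unfold batchMean
  induction b using Multiset.induction with
  | empty => simp
  | cons z b ih =>
    simp only [Multiset.map_cons, Multiset.sum_cons]
    exact (measurable_contribution f L τ z).add ih

variable (p : Params)

/-- Division of both noisy quantities by the expected batch size. -/
def normalize (r : Release d) : Release d := ((1 / p.B) • r.1, (1 / p.B) * r.2)

theorem measurable_normalize : Measurable (normalize p : Release d → Release d) := by
  unfold normalize; fun_prop

theorem batchRelease_eq (u : Param d × ℝ) (b : Multiset (X × Y)) :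
    batchRelease p f L u.1 u.2 b = (jointNoise d p.σgrad p.σcount).map
      fun w => normalize p (batchMean f L p.τ u b + w) := by
  simp only [batchMean_eq]
  rfl

theorem measurable_batchRelease (b : Multiset (X × Y)) :
    Measurable fun u : Param d × ℝ => batchRelease p f L u.1 u.2 b := by
  simp_rw [batchRelease_eq]
  exact measurable_map_family (κ := fun _ => jointNoise d p.σgrad p.σcount) measurable_const
    (fun _ => inferInstance) (g := fun a => normalize p (batchMean f L p.τ a.1 b + a.2))
    ((measurable_normalize p).comp
      (((measurable_batchMean f L p.τ b).comp measurable_fst).add measurable_snd))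

instance (θ : Param d) (C : ℝ) (b : Multiset (X × Y)) :
    IsProbabilityMeasure (batchRelease p f L θ C b) := by
  rw [batchRelease_eq f L p (θ, C)]
  exact Measure.isProbabilityMeasure_map
    ((measurable_normalize p).comp (measurable_const_add _)).aemeasurable

/-- The contribution of a sample, set to `0` at non-positive clipping bounds, which no run ever
reaches. -/
def guardedContribution (τ : ℝ) (u : Param d × ℝ) (z : X × Y) : Release d :=
  if 0 < u.2 then contribution f L τ u z else 0

theorem measurable_guardedContribution (τ : ℝ) (z : X × Y) :
    Measurable fun u : Param d × ℝ => guardedContribution f L τ u z :=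
  Measurable.ite (measurableSet_lt measurable_const measurable_snd)
    (measurable_contribution f L τ z) measurable_const

variable {p}

/-- Thanks to the guard the bound holds at every state. At negative clipping bounds the normalized
gradient could be arbitrarily long. -/
theorem noiseNormSq_guardedContribution_le (hgrad : 0 < p.σgrad) (hcount : 0 < p.σcount)
    (τ : ℝ) (u : Param d × ℝ) (z : X × Y) :
    noiseNormSq p.σgrad p.σcount (guardedContribution f L τ u z)
      * effectiveNoise p.σgrad p.σcount ^ 2 ≤ 1 := by
  refine noiseNormSq_mul_effectiveNoise_le hgrad hcount ?_ ?_ <;>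
  · unfold guardedContribution contribution
    split_ifs with hC <;> simp [norm_clip_le, *]

variable (p)

/-- Simulation of the noisy quantities of one iteration from one output `x` of the
one-dimensional mechanism: `x` is spread along the contribution of the sample `z`. -/
def simulateStep (D : Multiset (X × Y)) (z : X × Y) (u : Param d × ℝ) (x : ℝ) :
    Measure (Release d) :=
  poissonSubsample p.q D fun b => (jointNoise d p.σgrad p.σcount).map fun w =>
    normalize p (batchMean f L p.τ u b + simulate p.σgrad p.σcount
      (effectiveNoise p.σgrad p.σcount) (guardedContribution f L p.τ u z) x w)

theorem measurable_simulated (z : X × Y) (b : Multiset (X × Y)) :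
    Measurable fun a : ((Param d × ℝ) × ℝ) × Release d =>
      normalize p (batchMean f L p.τ a.1.1 b + simulate p.σgrad p.σcount
        (effectiveNoise p.σgrad p.σcount) (guardedContribution f L p.τ a.1.1 z) a.1.2 a.2) := by
  refine (measurable_normalize p).comp
    (((measurable_batchMean f L p.τ b).comp (measurable_fst.comp measurable_fst)).add ?_)
  exact (measurable_simulate _ _ _).comp
    (((measurable_guardedContribution f L p.τ z).comp (measurable_fst.comp measurable_fst)).prodMk
      ((measurable_snd.comp measurable_fst).prodMk measurable_snd))

theorem measurable_simulateStep (D : Multiset (X × Y)) (z : X × Y) :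
    Measurable fun a : (Param d × ℝ) × ℝ => simulateStep f L p D z a.1 a.2 :=
  measurable_poissonSubsample p.q D fun b =>
    measurable_map_family (κ := fun _ => jointNoise d p.σgrad p.σcount) measurable_const
      (fun _ => inferInstance) (measurable_simulated f L p z b)

theorem measurable_simulateStep_right (D : Multiset (X × Y)) (z : X × Y) (u : Param d × ℝ) :
    Measurable (simulateStep f L p D z u) := by
  have h := measurable_simulateStep f L p D z
  generalize simulateStep f L p D z = F at h ⊢
  exact h.comp measurable_prodMk_left

variable {p}

theorem isProbabilityMeasure_simulateStep (hq : 0 ≤ p.q) (hq1 : p.q ≤ 1) (D : Multiset (X × Y))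
    (z : X × Y) (u : Param d × ℝ) (x : ℝ) :
    IsProbabilityMeasure (simulateStep f L p D z u x) := by
  unfold simulateStep
  refine isProbabilityMeasure_poissonSubsample hq hq1 D fun b => ?_
  have hm := (measurable_simulated f L p z b).comp (measurable_prodMk_left (x := (u, x)))
  exact Measure.isProbabilityMeasure_map hm.aemeasurable

theorem bind_simulateStep (D : Multiset (X × Y)) (z : X × Y) (u : Param d × ℝ) (μ : Measure ℝ)
    [SFinite μ] :
    μ.bind (simulateStep f L p D z u) = poissonSubsample p.q D fun b =>
      ((μ.prod (jointNoise d p.σgrad p.σcount)).map fun a => simulate p.σgrad p.σcount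
        (effectiveNoise p.σgrad p.σcount) (guardedContribution f L p.τ u z) a.1 a.2).map
        fun w => normalize p (batchMean f L p.τ u b + w) := by
  have hm : ∀ b, Measurable fun a : ℝ × Release d =>
      normalize p (batchMean f L p.τ u b + simulate p.σgrad p.σcount
        (effectiveNoise p.σgrad p.σcount) (guardedContribution f L p.τ u z) a.1 a.2) := fun b =>
    (measurable_simulated f L p z b).comp
      (f := fun a : ℝ × Release d => ((u, a.1), a.2)) (by fun_prop)
  have hs : Measurable fun a : ℝ × Release d => simulate p.σgrad p.σcount
      (effectiveNoise p.σgrad p.σcount) (guardedContribution f L p.τ u z) a.1 a.2 :=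
    (measurable_simulate _ _ _).comp measurable_prodMk_left
  unfold simulateStep
  rw [bind_poissonSubsample p.q D μ fun b =>
    measurable_map_family (κ := fun _ => jointNoise d p.σgrad p.σcount) measurable_const
      (fun _ => inferInstance) (hm b)]
  congr 1
  funext b
  have hb : Measurable fun w => normalize p (batchMean f L p.τ u b + w) :=
    (measurable_normalize p).comp (measurable_const_add _)
  rw [bind_map_family (hm b), Measure.map_map hb hs]
  rfl

/-- With a centred input the simulated noise has the true law whatever the shift, so `z` leaves no
trace. No positivity of the clipping bound is needed. -/
theorem gaussianReal_bind_simulateStep (hgrad : 0 < p.σgrad) (hcount : 0 < p.σcount)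
    (D : Multiset (X × Y)) (z : X × Y) (u : Param d × ℝ) :
    (gaussianReal 0 (effectiveNoise p.σgrad p.σcount ^ 2).toNNReal).bind
        (simulateStep f L p D z u)
      = poissonSubsample p.q D (batchRelease p f L u.1 u.2) := by
  rw [bind_simulateStep, map_simulate_zero hgrad.ne' hcount.ne'
    (noiseNormSq_guardedContribution_le f L hgrad hcount _ _ _)]
  simp_rw [← batchRelease_eq]

/-- The two mixture components of the input match the two cases for `z`: mean `0` when it is
discarded, mean `1` when it is kept, with the same weights. -/
theorem subsampledGaussian_bind_simulateStep (hq : 0 ≤ p.q) (hq1 : p.q ≤ 1)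
    (hgrad : 0 < p.σgrad) (hcount : 0 < p.σcount)
    (D : Multiset (X × Y)) (z : X × Y) {u : Param d × ℝ} (hu : 0 < u.2) :
    (subsampledGaussian p.q (effectiveNoise p.σgrad p.σcount)).bind (simulateStep f L p D z u)
      = poissonSubsample p.q (z ::ₘ D) (batchRelease p f L u.1 u.2) := by
  rw [subsampledGaussian, add_smul_bind _ _ _ _ (measurable_simulateStep_right f L p D z u),
    gaussianReal_bind_simulateStep f L hgrad hcount, bind_simulateStep,
    map_simulate_one hgrad.ne' hcount.ne'
      (noiseNormSq_guardedContribution_le f L hgrad hcount _ _ _),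
    poissonSubsample_cons hq hq1]
  congr 3
  funext b
  have hb : Measurable fun w => normalize p (batchMean f L p.τ u b + w) :=
    (measurable_normalize p).comp (measurable_const_add _)
  rw [Measure.map_map hb (measurable_const_add _), batchRelease_eq]
  congr 1
  funext w
  simp only [Function.comp, guardedContribution, if_pos hu, batchMean, Multiset.map_cons,
    Multiset.sum_cons]
  rw [← add_assoc, add_comm (Multiset.sum _)]

end Step

/-! ### The whole run -/

section Run

/-! ### Adaptive composition of kernels driven by independent draws. -/

theorem lintegral_iterLaw_succ {n : ℕ} (μ : Measure ℝ) [IsProbabilityMeasure μ]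
    {F : (Fin (n + 1) → ℝ) → ℝ≥0∞} (hF : Measurable F) :
    ∫⁻ x, F x ∂(iterLaw (n + 1) μ)
      = ∫⁻ x, ∫⁻ y, F (Fin.snoc (α := fun _ => ℝ) x y) ∂μ ∂(iterLaw n μ) := by
  have h := (measurePreserving_piFinSuccAbove (fun _ : Fin (n + 1) => μ) (Fin.last n)).symm
  have hF' : Measurable fun a => F ((MeasurableEquiv.piFinSuccAbove (fun _ => ℝ) (Fin.last n)).symm
      a) := hF.comp h.measurable
  rw [iterLaw, ← h.lintegral_comp hF, lintegral_prod_symm' _ hF']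
  simp only [MeasurableEquiv.piFinSuccAbove_symm_apply, Fin.insertNthEquiv, Equiv.coe_fn_mk,
    Fin.insertNth_last']
  rfl

theorem measurable_finInit (n : ℕ) :
    Measurable fun x : Fin (n + 1) → ℝ => (Fin.init x : Fin n → ℝ) :=
  measurable_pi_iff.2 fun i => measurable_pi_apply i.castSucc

/-- One more adaptive step of a family of measures, driven by the last coordinate. -/
def adaptiveBind {R R' : Type*} [MeasurableSpace R] [MeasurableSpace R'] {n : ℕ}
    (K : (Fin n → ℝ) → Measure R) (J : R × ℝ → Measure R') (x : Fin (n + 1) → ℝ) : Measure R' :=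
  (K (Fin.init x)).bind fun h => J (h, x (Fin.last n))

theorem measurable_adaptiveBind {R R' : Type*} [MeasurableSpace R] [MeasurableSpace R'] {n : ℕ}
    {K : (Fin n → ℝ) → Measure R} (hK : Measurable K)
    (hK1 : ∀ x, IsProbabilityMeasure (K x)) {J : R × ℝ → Measure R'} (hJ : Measurable J) :
    Measurable (adaptiveBind K J) := by
  have hm : Measurable fun a : (Fin (n + 1) → ℝ) × R => (a.2, a.1 (Fin.last n)) := by fun_prop
  have hK' : Measurable fun x : Fin (n + 1) → ℝ => K (Fin.init x) :=
    hK.comp (measurable_finInit n)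
  have hJ' : Measurable fun a : (Fin (n + 1) → ℝ) × R => J (a.2, a.1 (Fin.last n)) := hJ.comp hm
  unfold adaptiveBind
  exact measurable_bind_family (η := fun a => J (a.2, a.1 (Fin.last n))) hK'
    (fun x => hK1 (Fin.init x)) hJ'

/-- Adaptive composition: feeding the last of `n + 1` independent draws into a further kernel. -/
theorem iterLaw_succ_bind {R R' : Type*} [MeasurableSpace R] [MeasurableSpace R'] {n : ℕ}
    (μ : Measure ℝ) [IsProbabilityMeasure μ] {K : (Fin n → ℝ) → Measure R} (hK : Measurable K)
    (hK1 : ∀ x, IsProbabilityMeasure (K x)) {J : R × ℝ → Measure R'} (hJ : Measurable J) :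
    (iterLaw (n + 1) μ).bind (adaptiveBind K J)
      = ((iterLaw n μ).bind K).bind fun h => μ.bind fun y => J (h, y) := by
  have hKJ := measurable_adaptiveBind hK hK1 hJ
  have hμJ : Measurable fun h => μ.bind fun y => J (h, y) :=
    measurable_bind_family (κ := fun _ : R => μ) measurable_const (fun _ => inferInstance) hJ
  have hyJ : ∀ y, Measurable fun r => J (r, y) := fun y => hJ.comp measurable_prodMk_right
  have hrJ : ∀ r, Measurable fun y => J (r, y) := fun r => hJ.comp measurable_prodMk_left
  ext s hs
  have hJs : Measurable fun a => J a s := (Measure.measurable_coe hs).comp hJ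
  have hKJs : Measurable fun x => adaptiveBind K J x s := (Measure.measurable_coe hs).comp hKJ
  have hμJs : Measurable fun h => (μ.bind fun y => J (h, y)) s :=
    (Measure.measurable_coe hs).comp hμJ
  rw [Measure.bind_apply hs hKJ.aemeasurable, Measure.bind_apply hs hμJ.aemeasurable,
    Measure.lintegral_bind hK.aemeasurable hμJs.aemeasurable, lintegral_iterLaw_succ μ hKJs]
  refine lintegral_congr fun x => ?_
  have := hK1 x
  simp only [adaptiveBind, Fin.init_snoc, Fin.snoc_last]
  simp_rw [Measure.bind_apply hs (hyJ _).aemeasurable, Measure.bind_apply hs (hrJ _).aemeasurable]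
  -- Tonelli: the last draw is independent of the transcript built from the earlier ones.
  exact lintegral_lintegral_swap (hJs.comp measurable_swap).aemeasurable

/-! ### Transcripts and their simulation. -/

variable {X Y O S : Type*} [MeasurableSpace S] {d : ℕ} (p : Params) (f : Param d → X → O)
  (L : O → Y → ℝ) (opt : S × Param d → Param d → S × Param d) (init : Measure (S × Param d))

/-- A transcript extended by the noisy quantities of one more iteration. -/
def extend {n : ℕ} (a : Transcript S d n × Release d) : Transcript S d (n + 1) :=
  (nextState p opt a.1.1 a.2,
    Fin.snoc (α := fun _ => State S d × Release d) a.1.2 (a.1.1, a.2))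

variable {opt} in
theorem measurable_extend (hopt : Measurable (Function.uncurry opt)) (n : ℕ) :
    Measurable (extend p opt : Transcript S d n × Release d → Transcript S d (n + 1)) := by
  refine Measurable.prodMk ?_ (measurable_pi_iff.2 fun i => ?_)
  · have hu : Measurable fun a : Transcript S d n × Release d =>
        opt (a.1.1.1, a.1.1.2.1) a.2.1 :=
      hopt.comp (f := fun a : Transcript S d n × Release d => ((a.1.1.1, a.1.1.2.1), a.2.1))
        (by fun_prop)
    unfold nextState
    fun_prop
  · refine Fin.lastCases ?_ (fun j => ?_) i
    · simp only [Fin.snoc_last]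
      fun_prop
    · simp only [Fin.snoc_castSucc]
      fun_prop

/-- The law of one more iteration after the transcript `h`. -/
def stepLaw (D : Multiset (X × Y)) {n : ℕ} (h : Transcript S d n) :
    Measure (Transcript S d (n + 1)) :=
  (poissonSubsample p.q D (batchRelease p f L h.1.2.1 h.1.2.2)).map fun r => extend p opt (h, r)

theorem run_succ (D : Multiset (X × Y)) (n : ℕ) :
    run p f L opt init D (n + 1) = (run p f L opt init D n).bind (stepLaw p f L opt D) :=
  rfl

variable {p opt}

theorem isProbabilityMeasure_poissonSubsample_batchRelease (hq : 0 ≤ p.q) (hq1 : p.q ≤ 1)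
    (D : Multiset (X × Y)) (θ : Param d) (C : ℝ) :
    IsProbabilityMeasure (poissonSubsample p.q D (batchRelease p f L θ C)) :=
  isProbabilityMeasure_poissonSubsample hq hq1 D fun _ => inferInstance

theorem measurable_stepLaw (hq : 0 ≤ p.q) (hq1 : p.q ≤ 1)
    (hopt : Measurable (Function.uncurry opt)) (D : Multiset (X × Y)) (n : ℕ) :
    Measurable (stepLaw p f L opt D (n := n)) := by
  refine measurable_map_family (measurable_poissonSubsample p.q D fun b => ?_)
    (fun h => isProbabilityMeasure_poissonSubsample_batchRelease f L hq hq1 D _ _)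
    (measurable_extend p hopt n)
  exact (measurable_batchRelease f L p b).comp
    (f := fun h : Transcript S d n => (h.1.2.1, h.1.2.2)) (by fun_prop)

theorem isProbabilityMeasure_stepLaw (hq : 0 ≤ p.q) (hq1 : p.q ≤ 1)
    (hopt : Measurable (Function.uncurry opt)) (D : Multiset (X × Y)) {n : ℕ}
    (h : Transcript S d n) : IsProbabilityMeasure (stepLaw p f L opt D h) :=
  have := isProbabilityMeasure_poissonSubsample_batchRelease f L hq hq1 D h.1.2.1 h.1.2.2
  Measure.isProbabilityMeasure_map
    ((measurable_extend p hopt n).comp measurable_prodMk_left).aemeasurable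

theorem measurable_initialTranscript :
    Measurable fun u : S × Param d =>
      (((u.1, u.2, p.C₀), Fin.elim0) : Transcript S d 0) :=
  Measurable.prodMk (by fun_prop) measurable_const

theorem isProbabilityMeasure_run [IsProbabilityMeasure init] (hq : 0 ≤ p.q) (hq1 : p.q ≤ 1)
    (hopt : Measurable (Function.uncurry opt)) (D : Multiset (X × Y)) :
    ∀ n, IsProbabilityMeasure (run p f L opt init D n)
  | 0 => Measure.isProbabilityMeasure_map measurable_initialTranscript.aemeasurable
  | n + 1 =>
    have := isProbabilityMeasure_run hq hq1 hopt D n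
    isProbabilityMeasure_bind_family (measurable_stepLaw f L hq hq1 hopt D n)
      (isProbabilityMeasure_stepLaw f L hq hq1 hopt D)

theorem measurable_extend_right (hopt : Measurable (Function.uncurry opt)) {n : ℕ}
    (h : Transcript S d n) : Measurable fun r => extend p opt (h, r) := by
  have hm := measurable_extend p hopt n
  generalize extend p opt = F at hm ⊢
  exact hm.comp measurable_prodMk_left

/-- The clipping bound stays positive. -/
theorem ae_run_clippingBound_pos (hq : 0 ≤ p.q) (hq1 : p.q ≤ 1) (hC : 0 < p.C₀)
    (hopt : Measurable (Function.uncurry opt)) (D : Multiset (X × Y)) :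
    ∀ n, ∀ᵐ h ∂run p f L opt init D n, 0 < h.1.2.2
  | 0 => by
    rw [run, ae_map_iff measurable_initialTranscript.aemeasurable
      (measurableSet_lt measurable_const (by fun_prop))]
    exact Filter.Eventually.of_forall fun _ => hC
  | n + 1 => by
    have hS : MeasurableSet {h : Transcript S d (n + 1) | ¬ 0 < h.1.2.2} :=
      (measurableSet_lt (f := fun _ : Transcript S d (n + 1) => (0 : ℝ)) (g := fun h => h.1.2.2)
        measurable_const (by fun_prop)).compl
    have hm := measurable_stepLaw f L hq hq1 hopt D n
    have hmS : Measurable fun h => stepLaw p f L opt D h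
        {h : Transcript S d (n + 1) | ¬ 0 < h.1.2.2} := (Measure.measurable_coe hS).comp hm
    rw [run_succ, ae_iff, Measure.bind_apply hS hm.aemeasurable, lintegral_eq_zero_iff hmS]
    filter_upwards [ae_run_clippingBound_pos hq hq1 hC hopt D n] with h hh
    rw [stepLaw, Measure.map_apply (measurable_extend_right hopt h) hS]
    have hempty : (fun r => extend p opt (h, r)) ⁻¹'
        {h : Transcript S d (n + 1) | ¬ 0 < h.1.2.2} = ∅ :=
      -- The second argument of the maximum is already positive, so the lower bound may have any
      -- sign.
      Set.eq_empty_of_forall_notMem fun r hr =>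
        hr (lt_max_of_lt_right (mul_pos hh (Real.exp_pos _)))
    rw [hempty, measure_empty, Pi.zero_apply]

variable (p opt) in
/-- Simulation of one more iteration after a transcript, from one output of the one-dimensional
mechanism. -/
def simulateLaw (D : Multiset (X × Y)) (z : X × Y) {n : ℕ} (a : Transcript S d n × ℝ) :
    Measure (Transcript S d (n + 1)) :=
  (simulateStep f L p D z (a.1.1.2.1, a.1.1.2.2) a.2).map fun r => extend p opt (a.1, r)

theorem measurable_simulateLaw (hq : 0 ≤ p.q) (hq1 : p.q ≤ 1)
    (hopt : Measurable (Function.uncurry opt)) (D : Multiset (X × Y)) (z : X × Y) (n : ℕ) :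
    Measurable (simulateLaw p f L opt D z (n := n)) := by
  have hm := measurable_simulateStep f L p D z
  have hm1 := isProbabilityMeasure_simulateStep f L hq hq1 D z
  have hext := measurable_extend p hopt n
  unfold simulateLaw
  generalize simulateStep f L p D z = F at hm hm1 ⊢
  generalize extend p opt = E at hext ⊢
  have h1 : Measurable fun a : Transcript S d n × ℝ => ((a.1.1.2.1, a.1.1.2.2), a.2) := by
    fun_prop
  have h2 : Measurable fun a : (Transcript S d n × ℝ) × Release d => (a.1.1, a.2) := by
    fun_prop
  exact measurable_map_family (hm.comp h1) (fun a => hm1 _ _) (hext.comp h2)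

theorem isProbabilityMeasure_simulateLaw (hq : 0 ≤ p.q) (hq1 : p.q ≤ 1)
    (hopt : Measurable (Function.uncurry opt)) (D : Multiset (X × Y)) (z : X × Y) {n : ℕ}
    (a : Transcript S d n × ℝ) : IsProbabilityMeasure (simulateLaw p f L opt D z a) :=
  have := isProbabilityMeasure_simulateStep f L hq hq1 D z (a.1.1.2.1, a.1.1.2.2) a.2
  Measure.isProbabilityMeasure_map (measurable_extend_right hopt a.1).aemeasurable

theorem bind_simulateLaw (hopt : Measurable (Function.uncurry opt)) (D : Multiset (X × Y))
    (z : X × Y) {n : ℕ} (μ : Measure ℝ) (h : Transcript S d n) :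
    μ.bind (fun y => simulateLaw p f L opt D z (h, y))
      = (μ.bind (simulateStep f L p D z (h.1.2.1, h.1.2.2))).map
          fun r => extend p opt (h, r) :=
  (map_bind_family (κ := simulateStep f L p D z (h.1.2.1, h.1.2.2))
    (g := fun r => extend p opt (h, r)) (measurable_simulateStep_right f L p D z _)
    (measurable_extend_right hopt h)).symm

/-- The runs on a dataset with and without the sample `z` are the images, under one and the same
Markov kernel, of `T` independent steps of the one-dimensional mechanism. -/
theorem exists_simulation [IsProbabilityMeasure init] (hq : 0 ≤ p.q) (hq1 : p.q ≤ 1)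
    (hC : 0 < p.C₀) (hgrad : 0 < p.σgrad) (hcount : 0 < p.σcount)
    (hopt : Measurable (Function.uncurry opt)) (D : Multiset (X × Y)) (z : X × Y) :
    ∀ n, ∃ K : (Fin n → ℝ) → Measure (Transcript S d n), Measurable K ∧
      (∀ x, IsProbabilityMeasure (K x)) ∧
      (iterLaw n (gaussianReal 0 (effectiveNoise p.σgrad p.σcount ^ 2).toNNReal)).bind K
        = run p f L opt init D n ∧
      (iterLaw n (subsampledGaussian p.q (effectiveNoise p.σgrad p.σcount))).bind K
        = run p f L opt init (z ::ₘ D) n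
  | 0 => by
    -- Before the first iteration the transcript does not depend on the data, so a constant kernel
    -- serves both datasets.
    refine ⟨fun _ => run p f L opt init D 0, measurable_const,
      fun _ => isProbabilityMeasure_run f L init hq hq1 hopt D 0, ?_, ?_⟩ <;>
    simp [Measure.bind_const, iterLaw, run]
  | n + 1 => by
    obtain ⟨K, hK, hK1, hK0, hKz⟩ := exists_simulation hq hq1 hC hgrad hcount hopt D z n
    have := isProbabilityMeasure_subsampledGaussian hq hq1 (effectiveNoise p.σgrad p.σcount)
    have hJ := measurable_simulateLaw f L hq hq1 hopt D z n
    refine ⟨adaptiveBind K _, measurable_adaptiveBind hK hK1 hJ, fun x => ?_, ?_, ?_⟩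
    · have := hK1 (Fin.init x)
      have hJx : Measurable fun h => simulateLaw p f L opt D z (h, x (Fin.last n)) :=
        hJ.comp measurable_prodMk_right
      exact isProbabilityMeasure_bind_family hJx
        fun h => isProbabilityMeasure_simulateLaw f L hq hq1 hopt D z (h, x (Fin.last n))
    · rw [iterLaw_succ_bind _ hK hK1 hJ, hK0, run_succ]
      congr 1
      funext h
      rw [bind_simulateLaw f L hopt, gaussianReal_bind_simulateStep f L hgrad hcount]
      rfl
    · rw [iterLaw_succ_bind _ hK hK1 hJ, hKz, run_succ]
      -- With `z` present the one-step identity requires a positive clipping bound, which holds only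
      -- almost surely; without `z` it holds at every transcript.
      refine Measure.bind_congr_right ?_
      filter_upwards [ae_run_clippingBound_pos f L init hq hq1 hC hopt (z ::ₘ D) n] with h hh
      rw [bind_simulateLaw f L hopt, subsampledGaussian_bind_simulateStep f L hq hq1 hgrad hcount D z hh]
      rfl

/-- Adding and removing a sample use the two directions of the privacy profile, through the same
simulation kernel. -/
theorem isDP_fullRun [IsProbabilityMeasure init] (hq : 0 ≤ p.q) (hq1 : p.q ≤ 1)
    (hC : 0 < p.C₀) (hgrad : 0 < p.σgrad) (hcount : 0 < p.σcount)
    (hopt : Measurable (Function.uncurry opt)) {ε δ : ℝ}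
    (h : privacyProfile p.T p.q (effectiveNoise p.σgrad p.σcount) ε ≤ ENNReal.ofReal δ) :
    IsDP (fullRun p f L opt init) ε δ := by
  rintro D D' (⟨z, rfl⟩ | ⟨z, rfl⟩) A hA
  · obtain ⟨K, hK, hK1, hK0, hKz⟩ :=
      exists_simulation f L init hq hq1 hC hgrad hcount hopt D z p.T
    rw [fullRun, fullRun, ← hK0, ← hKz]
    exact bind_le_of_hockeyStick_le ((le_max_right _ _).trans h) hK hK1 hA
  · obtain ⟨K, hK, hK1, hK0, hKz⟩ :=
      exists_simulation f L init hq hq1 hC hgrad hcount hopt D' z p.T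
    rw [fullRun, fullRun, ← hK0, ← hKz]
    exact bind_le_of_hockeyStick_le ((le_max_left _ _).trans h) hK hK1 hA

/-- Differential privacy is closed under deterministic post-processing. -/
theorem IsDP.map {Z R R' : Type*} [MeasurableSpace R] [MeasurableSpace R']
    {M : Multiset Z → Measure R} {ε δ : ℝ} (h : IsDP M ε δ) {g : R → R'} (hg : Measurable g) :
    IsDP (fun D => (M D).map g) ε δ := fun D D' hD A hA => by
  rw [Measure.map_apply hg hA, Measure.map_apply hg hA]
  exact h D D' hD _ (hg hA)

end Run

end AdaptiveClipping

end

theorem mainTheorem1 {X Y O S : Type*} [MeasurableSpace S] {d : ℕ}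
    (p : AdaptiveClipping.Params)
    (hN : 0 < p.N) (hq : 0 < p.q) (hq1 : p.q ≤ 1) (hC : 0 < p.C₀)
    (hgrad : 0 < p.σgrad) (hcount : 0 < p.σcount)
    (f : AdaptiveClipping.Param d → X → O) (L : O → Y → ℝ)
    (opt : S × AdaptiveClipping.Param d → AdaptiveClipping.Param d →
      S × AdaptiveClipping.Param d)
    (hopt : Measurable (Function.uncurry opt))
    (init : Measure (S × AdaptiveClipping.Param d)) [IsProbabilityMeasure init] :
    (∀ D : Multiset (X × Y),
      IsProbabilityMeasure (AdaptiveClipping.fullRun p f L opt init D) ∧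
      IsProbabilityMeasure (AdaptiveClipping.finalModel p f L opt init D)) ∧
    ∀ ε δ : ℝ,
      (AdaptiveClipping.ProfileAccountantReturns p.T p.q
          (AdaptiveClipping.effectiveNoise p.σgrad p.σcount) ε δ ∨
        AdaptiveClipping.RDPAccountantReturns p.T p.q
          (AdaptiveClipping.effectiveNoise p.σgrad p.σcount) ε δ) →
      AdaptiveClipping.IsDP (AdaptiveClipping.fullRun p f L opt init) ε δ ∧
      AdaptiveClipping.IsDP (AdaptiveClipping.finalModel p f L opt init) ε δ := by
  have hfinal : Measurable fun h : AdaptiveClipping.Transcript S d p.T => h.1.2.1 := by fun_prop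
  refine ⟨fun D => ?_, fun ε δ h => ?_⟩
  · have hrun : IsProbabilityMeasure (AdaptiveClipping.fullRun p f L opt init D) :=
      AdaptiveClipping.isProbabilityMeasure_run f L init hq.le hq1 hopt D p.T
    exact ⟨hrun, Measure.isProbabilityMeasure_map hfinal.aemeasurable⟩
  · have hfull := AdaptiveClipping.isDP_fullRun f L init hq.le hq1 hC hgrad hcount hopt
      (AdaptiveClipping.privacyProfile_le_of_accountant hq hq1
        (AdaptiveClipping.effectiveNoise_pos hgrad hcount) h)
    exact ⟨hfull, hfull.map hfinal⟩
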